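/- Let $n\ge 0$, $[n]=\{1,\dots,n\}$, and let $K\subsetneq 2^{[n]}$ be a proper simplicial complex (a family of subsets of $[n]$ closed under taking subsets, with $\emptyset\in K$) such that $\{i\}\in K$ for every $i\in[n]$. Let $\Gamma=2^{[n]}\setminus K$, and let $K^\circ=\{A\subseteq[n] : [n]\setminus A\notin K\}$ be the Alexander dual of $K$. The simple game $\Gamma$ (a family of subsets of $[n]$ closed under taking supersets, with $[n]\in\Gamma$ and $\emptyset\notin\Gamma$) is called roughly weighted with strictly positive weights if there are real numbers $w_1,\dots,w_n>0$ and $q>0$ such that for every $X\subseteq[n]$: $\sum_{i\in X}w_i>q$ implies $X\in\Gamma$, and $\sum_{i\in X}w_i<q$ implies $X\in K$. Let $H_0=\{x\in\mathbb{R}^n : x_1+\dots+x_n=0\}$ and $\delta_i=e_i-\frac1n(e_1+\dots+e_n)\in H_0$. The canonical fan $\mathrm{Fan}(\Gamma)$ is the collection of the convex cones in $H_0$ generated by $\{\delta_i : i\in A_1\}\cup\{-\delta_j : j\in A_2\}$, over all pairs of disjoint sets $A_1\in K$, $A_2\in K^\circ$. It is called pseudo-polytopal if it refines the normal fan of a full-dimensional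 convex polytope $Q\subset H_0$. Here the normal fan of $Q$ consists of the cones $\{v\in H_0 : \langle v,y\rangle\le\langle v,x\rangle \text{ for all } x\in F,\ y\in Q\}$, where $F$ ranges over the nonempty faces of $Q$ ($Q$ included), and a fan refines another one if both have the same union and every cone of the first is contained in a cone of the second. Then $\Gamma$ is roughly weighted with strictly positive weights if and only if $\mathrm{Fan}(\Gamma)$ is pseudo-polytopal. -/

import Mathlib

open scoped RealInnerProductSpace

noncomputable section

namespace BierFan

/-! ### Simplicial complexes and simple games -/

/-- A simplicial complex on `[n]`: a down-set of subsets that contains the empty set. -/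
structure IsComplex {n : ℕ} (K : Set (Finset (Fin n))) : Prop where
  empty_mem : ∅ ∈ K
  isLowerSet : IsLowerSet K

/-- The vertices of a family `K`; the elements outside `vert K` are the ghost vertices. -/
def vert {n : ℕ} (K : Set (Finset (Fin n))) : Set (Fin n) := {i | {i} ∈ K}

/-- The Alexander dual `{A | [n] \ A ∉ K}`. -/
def alexanderDual {n : ℕ} (K : Set (Finset (Fin n))) : Set (Finset (Fin n)) :=
  {A | Aᶜ ∉ K}

/-- A simple game with player set `[n]`, given by its winning coalitions. -/
structure IsSimpleGame {n : ℕ} (W : Set (Finset (Fin n))) : Prop where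
  univ_mem : Finset.univ ∈ W
  empty_notMem : ∅ ∉ W
  isUpperSet : IsUpperSet W

/-- A roughly weighted simple game with strictly positive weights `w` and positive quota `q`. -/
def IsRoughlyWeighted {n : ℕ} (W : Set (Finset (Fin n))) : Prop :=
  IsSimpleGame W ∧
    ∃ (w : Fin n → ℝ) (q : ℝ), (∀ i, 0 < w i) ∧ 0 < q ∧
      ∀ X : Finset (Fin n),
        (q < ∑ i ∈ X, w i → X ∈ W) ∧ (∑ i ∈ X, w i < q → X ∉ W)

/-! ### The canonical fan -/

/-- The space `H₀ = {x ∈ ℝⁿ | x₁ + ⋯ + xₙ = 0}`, with the inner product of `ℝⁿ`. -/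
def H₀ (n : ℕ) : Submodule ℝ (EuclideanSpace ℝ (Fin n)) where
  carrier := {x | ∑ i, x i = 0}
  zero_mem' := by simp
  add_mem' := by
    intro x y hx hy
    simp only [Set.mem_ofPred_eq, PiLp.add_apply, Finset.sum_add_distrib] at *
    rw [hx, hy, add_zero]
  smul_mem' := by
    intro c x hx
    simp only [Set.mem_ofPred_eq, PiLp.smul_apply, smul_eq_mul, ← Finset.mul_sum] at *
    rw [hx, mul_zero]

/-- The vector `δ_i = e_i - (1/n) (e_1 + ⋯ + e_n)`, as an element of `H₀`. -/
def δ {n : ℕ} (i : Fin n) : H₀ n :=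
  ⟨EuclideanSpace.single i (1 : ℝ) -
      (1 / (n : ℝ)) • ∑ j : Fin n, EuclideanSpace.single j (1 : ℝ), by
    have hn : (n : ℝ) ≠ 0 := by
      have := i.pos
      positivity
    change ∑ k, _ = (0 : ℝ)
    simp [Finset.sum_apply, Pi.single_apply, hn]⟩

/-- The convex cone generated by `δ_i`, `i ∈ A₁`, and `-δ_j`, `j ∈ A₂`. -/
def cone {n : ℕ} (A₁ A₂ : Finset (Fin n)) : PointedCone ℝ (H₀ n) :=
  PointedCone.hull ℝ (δ '' (A₁ : Set (Fin n)) ∪ (fun j => -δ j) '' (A₂ : Set (Fin n)))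

/-- The canonical fan of `K`: the cones over the simplices of the Bier sphere, that is, of the
deleted join of `K` and its Alexander dual. -/
def canonicalFan {n : ℕ} (K : Set (Finset (Fin n))) : Set (PointedCone ℝ (H₀ n)) :=
  {C | ∃ A₁ A₂ : Finset (Fin n),
    A₁ ∈ K ∧ A₂ ∈ alexanderDual K ∧ Disjoint A₁ A₂ ∧ C = cone A₁ A₂}

/-! ### Polytopes, normal fans, refinement -/

section Fans

variable {V : Type*} [NormedAddCommGroup V] [InnerProductSpace ℝ V]

/-- A full-dimensional convex polytope. -/
def IsFullDimPolytope (Q : Set V) : Prop :=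
  (∃ s : Finset V, Q = convexHull ℝ (s : Set V)) ∧ (interior Q).Nonempty

/-- The (outer) normal cone of `Q` at `F ⊆ Q`: the vectors `v` such that `⟪v, ·⟫` attains its
maximum over `Q` at every point of `F`. -/
def normalCone (Q F : Set V) : PointedCone ℝ V where
  carrier := {v | ∀ x ∈ F, ∀ y ∈ Q, ⟪v, y⟫ ≤ ⟪v, x⟫}
  zero_mem' := by simp
  add_mem' := by
    intro v w hv hw x hx y hy
    simp only [inner_add_left]
    exact add_le_add (hv x hx y hy) (hw x hx y hy)
  smul_mem' := by
    intro c v hv x hx y hy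
    change ⟪(c : ℝ) • v, y⟫ ≤ ⟪(c : ℝ) • v, x⟫
    simp only [real_inner_smul_left]
    exact mul_le_mul_of_nonneg_left (hv x hx y hy) c.2

/-- The normal fan of `Q`: the normal cones of its nonempty faces. -/
def normalFan (Q : Set V) : Set (PointedCone ℝ V) :=
  {C | ∃ F : Set V, F.Nonempty ∧ IsExposed ℝ Q F ∧ C = normalCone Q F}

/-- `𝓕` refines `𝓖`: both have the same support and each cone of `𝓕` lies in a cone of `𝓖`. -/
def Refines (𝓕 𝓖 : Set (PointedCone ℝ V)) : Prop :=
  (⋃ C ∈ 𝓕, (C : Set V)) = (⋃ D ∈ 𝓖, (D : Set V)) ∧ ∀ C ∈ 𝓕, ∃ D ∈ 𝓖, C ≤ D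

/-- A fan in `V` is pseudo-polytopal if it refines the normal fan of a (full-dimensional)
convex polytope in `V`. -/
def IsPseudoPolytopal (𝓕 : Set (PointedCone ℝ V)) : Prop :=
  ∃ Q : Set V, IsFullDimPolytope Q ∧ Refines 𝓕 (normalFan Q)

end Fans

end BierFan

end

open scoped RealInnerProductSpace

namespace BierFan

variable {n : ℕ}

/-! ### Coordinates on `H₀` -/

/-! The link between the two sides is `⟪δ i, y⟫ = y i` on `H₀`: a cone of the fan lies in a normal
cone of `Q` when some point of `Q` maximises the coordinates in `A₁` and minimises those in `A₂`.

Given weights, let `Q` be the slice by `H₀` of a box with side lengths `w i`, placed so that the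
corner that is upper exactly on `A` has coordinate sum `w(A) - q`. Rough weightedness gives these
sums the signs that make the face for `A₁`, `A₂` meet `H₀` (`boxFace_nonempty`). The supports agree
because the canonical fan is complete (`iUnion_canonicalFan`).

Given `Q`, let `u i`, `l i` be the extreme values of the `i`-th coordinate on it. The weights `u i -
l i` with quota `-∑ l i` work, since points of `Q` have coordinate sum zero. -/

theorem sum_coord_eq_zero (x : H₀ n) : ∑ i, x.1 i = 0 := x.2

theorem inner_δ (i : Fin n) (x : H₀ n) : ⟪δ i, x⟫ = x.1 i := by
  have hx := sum_coord_eq_zero x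
  change ⟪(δ i).1, x.1⟫ = x.1 i
  simp [δ, inner_sub_left, real_inner_smul_left, sum_inner, EuclideanSpace.inner_single_left, hx]

theorem δ_coord (i k : Fin n) : (δ i).1 k = (if k = i then 1 else 0) - 1 / (n : ℝ) := by
  simp [δ, Pi.single_apply]

theorem sum_smul_δ_coord (c : Fin n → ℝ) (k : Fin n) :
    (∑ i, c i • δ i : H₀ n).1 k = c k - (∑ i, c i) / n := by
  simp [δ_coord, mul_sub, Finset.sum_sub_distrib, div_eq_mul_inv, Finset.sum_mul]

/-- The `δ i` sum to zero, so all coefficients may be shifted by a common `t`; a suitable `t` gives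
them the signs that a cone requires. -/
theorem sum_sub_smul_δ (x : H₀ n) (t : ℝ) : ∑ i, (x.1 i - t) • δ i = x := by
  ext k
  have hn : (n : ℝ) ≠ 0 := by
    have := k.pos
    positivity
  rw [sum_smul_δ_coord]
  simp only [Finset.sum_sub_distrib, sum_coord_eq_zero x, Finset.sum_const, Finset.card_univ,
    Fintype.card_fin, nsmul_eq_mul]
  field_simp
  ring

/-- The inclusion of `H₀` into the space of all functions. -/
def coordMap (n : ℕ) : H₀ n →ₗ[ℝ] (Fin n → ℝ) where
  toFun x i := x.1 i
  map_add' _ _ := rfl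
  map_smul' _ _ := rfl

theorem coordMap_apply (x : H₀ n) (i : Fin n) : coordMap n x i = x.1 i := rfl

theorem coordMap_injective : Function.Injective (coordMap n) := by
  intro x y h
  ext i
  exact congrFun h i

theorem isClosedEmbedding_coordMap : Topology.IsClosedEmbedding (coordMap n) :=
  LinearMap.isClosedEmbedding_of_injective (LinearMap.ker_eq_bot.2 coordMap_injective)

theorem continuous_coord (i : Fin n) : Continuous fun x : H₀ n => x.1 i :=
  (continuous_apply i).comp (isClosedEmbedding_coordMap (n := n)).continuous

/-! ### Completeness of the canonical fan -/

theorem univ_notMem {K : Set (Finset (Fin n))} (hK : IsComplex K) (hproper : K ≠ Set.univ) :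
    Finset.univ ∉ K := fun h =>
  hproper (Set.eq_univ_of_forall fun A => hK.isLowerSet (Finset.subset_univ A) h)

/-- Take for `t` the largest value of `x` whose weak superlevel set is outside `K`. The strict
superlevel set at `t` is empty or is the weak one at the next larger value, hence lies in `K`. -/
theorem exists_threshold {K : Set (Finset (Fin n))} (hK : IsComplex K)
    (hproper : K ≠ Set.univ) (x : Fin n → ℝ) :
    ∃ t : ℝ, (Finset.univ.filter fun i => t < x i) ∈ K ∧
      (Finset.univ.filter fun i => t ≤ x i) ∉ K := by
  classical
  have huniv := univ_notMem hK hproper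
  have hne : (Finset.univ : Finset (Fin n)).Nonempty := by
    rw [Finset.nonempty_iff_ne_empty]
    intro h
    exact huniv (h ▸ hK.empty_mem)
  set T := Finset.univ.filter fun i => (Finset.univ.filter fun j => x i ≤ x j) ∉ K with hT
  have hTne : T.Nonempty := by
    obtain ⟨i, -, hi⟩ := Finset.exists_min_image _ x hne
    refine ⟨i, ?_⟩
    rw [hT, Finset.mem_filter]
    refine ⟨Finset.mem_univ _, ?_⟩
    rwa [Finset.filter_true_of_mem hi]
  obtain ⟨i, hiT, hi⟩ := Finset.exists_max_image T x hTne
  refine ⟨x i, ?_, (Finset.mem_filter.1 hiT).2⟩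
  by_contra hcon
  have hne' : (Finset.univ.filter fun j => x i < x j).Nonempty := by
    rw [Finset.nonempty_iff_ne_empty]
    intro h
    exact hcon (h ▸ hK.empty_mem)
  obtain ⟨j, hj, hjmin⟩ := Finset.exists_min_image _ x hne'
  have hj' : x i < x j := (Finset.mem_filter.1 hj).2
  refine absurd (hi j ?_) (not_le.2 hj')
  rw [hT, Finset.mem_filter]
  refine ⟨Finset.mem_univ _, ?_⟩
  have : (Finset.univ.filter fun k => x j ≤ x k) = Finset.univ.filter fun k => x i < x k := by
    ext k
    simp only [Finset.mem_filter, Finset.mem_univ, true_and]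
    exact ⟨hj'.trans_le, fun hk => hjmin k (by simpa using hk)⟩
  rwa [this]

theorem δ_mem_cone {A₁ A₂ : Finset (Fin n)} {i : Fin n} (hi : i ∈ A₁) : δ i ∈ cone A₁ A₂ :=
  Submodule.subset_span (Or.inl ⟨i, hi, rfl⟩)

theorem neg_δ_mem_cone {A₁ A₂ : Finset (Fin n)} {i : Fin n} (hi : i ∈ A₂) :
    -δ i ∈ cone A₁ A₂ :=
  Submodule.subset_span (Or.inr ⟨i, hi, rfl⟩)

theorem iUnion_canonicalFan {K : Set (Finset (Fin n))} (hK : IsComplex K)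
    (hproper : K ≠ Set.univ) : (⋃ C ∈ canonicalFan K, (C : Set (H₀ n))) = Set.univ := by
  refine Set.eq_univ_of_forall fun x => ?_
  obtain ⟨t, h₁, h₂⟩ := exists_threshold hK hproper (fun i => x.1 i)
  set A₁ := Finset.univ.filter fun i => t < x.1 i with hA₁
  set A₂ := Finset.univ.filter fun i => x.1 i < t with hA₂
  have hA₂c : A₂ᶜ = Finset.univ.filter fun i => t ≤ x.1 i := by
    ext i
    simp [hA₂]
  have hdisj : Disjoint A₁ A₂ := by
    rw [Finset.disjoint_left]
    intro i hi hi'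
    simp only [hA₁, hA₂, Finset.mem_filter, Finset.mem_univ, true_and] at hi hi'
    exact lt_asymm hi hi'
  refine Set.mem_biUnion (x := cone A₁ A₂) ⟨A₁, A₂, h₁, ?_, hdisj, rfl⟩ ?_
  · change A₂ᶜ ∉ K
    rwa [hA₂c]
  · change x ∈ cone A₁ A₂
    rw [← sum_sub_smul_δ x t]
    refine Submodule.sum_mem _ fun i _ => ?_
    rcases lt_trichotomy (x.1 i) t with h | h | h
    · rw [← neg_smul_neg]
      exact PointedCone.smul_mem _ (by linarith) (neg_δ_mem_cone (by simpa [hA₂] using h))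
    · rw [h, sub_self, zero_smul]
      exact Submodule.zero_mem _
    · exact PointedCone.smul_mem _ (by linarith) (δ_mem_cone (by simpa [hA₁] using h))

/-! ### Slices of boxes -/

/-- The intersection of `H₀` with the box `∏ [l i, u i]`. -/
def boxSlice (l u : Fin n → ℝ) : Set (H₀ n) := {y | ∀ i, l i ≤ y.1 i ∧ y.1 i ≤ u i}

theorem boxSlice_eq_preimage (l u : Fin n → ℝ) :
    boxSlice l u = coordMap n ⁻¹' Set.Icc l u := by
  ext y
  simp [boxSlice, Set.mem_Icc, Pi.le_def, forall_and, coordMap_apply]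

theorem convex_boxSlice (l u : Fin n → ℝ) : Convex ℝ (boxSlice l u) := by
  rw [boxSlice_eq_preimage]
  exact (convex_Icc l u).linear_preimage (coordMap n)

theorem isCompact_boxSlice (l u : Fin n → ℝ) : IsCompact (boxSlice l u) := by
  rw [boxSlice_eq_preimage]
  exact isClosedEmbedding_coordMap.isCompact_preimage isCompact_Icc

theorem zero_mem_interior_boxSlice {l u : Fin n → ℝ} (hl : ∀ i, l i < 0) (hu : ∀ i, 0 < u i) :
    (0 : H₀ n) ∈ interior (boxSlice l u) := by
  rw [mem_interior]
  refine ⟨⋂ i, {y : H₀ n | l i < y.1 i ∧ y.1 i < u i}, ?_, ?_, ?_⟩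
  · intro y hy i
    have := Set.mem_iInter.1 hy i
    exact ⟨this.1.le, this.2.le⟩
  · exact isOpen_iInter_of_finite fun i =>
      (isOpen_lt continuous_const (continuous_coord i)).inter
        (isOpen_lt (continuous_coord i) continuous_const)
  · exact Set.mem_iInter.2 fun i => ⟨hl i, hu i⟩

/-- An extreme point of a slice of a box is determined by the set of constraints that are
active at it. -/
theorem eq_of_mem_extremePoints_boxSlice {l u : Fin n → ℝ} {x y : H₀ n}
    (hx : x ∈ (boxSlice l u).extremePoints ℝ) (hl : ∀ i, x.1 i = l i → y.1 i = l i)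
    (hu : ∀ i, x.1 i = u i → y.1 i = u i) : x = y := by
  -- For small `ε` both `x ± ε (x - y)` stay in the box: active coordinates of `x` do not move and
  -- inactive ones have room. Extremality then forces `x = y`.
  have key : ∀ i, ∀ᶠ ε in nhds (0 : ℝ),
      (l i ≤ x.1 i + ε * (x.1 i - y.1 i) ∧ x.1 i + ε * (x.1 i - y.1 i) ≤ u i) ∧
      (l i ≤ x.1 i - ε * (x.1 i - y.1 i) ∧ x.1 i - ε * (x.1 i - y.1 i) ≤ u i) := by
    intro i
    obtain ⟨h₁, h₂⟩ := hx.1 i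
    by_cases hxl : x.1 i = l i
    · rw [hl i hxl, hxl]
      simp only [sub_self, mul_zero, add_zero, sub_zero]
      exact Filter.Eventually.of_forall fun _ => ⟨⟨le_rfl, hxl ▸ h₂⟩, le_rfl, hxl ▸ h₂⟩
    by_cases hxu : x.1 i = u i
    · rw [hu i hxu, hxu]
      simp only [sub_self, mul_zero, add_zero, sub_zero]
      exact Filter.Eventually.of_forall fun _ => ⟨⟨hxu ▸ h₁, le_rfl⟩, hxu ▸ h₁, le_rfl⟩
    have h₁' : l i < x.1 i := lt_of_le_of_ne h₁ (Ne.symm hxl)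
    have h₂' : x.1 i < u i := lt_of_le_of_ne h₂ hxu
    have c₁ : Filter.Tendsto (fun ε : ℝ => x.1 i + ε * (x.1 i - y.1 i)) (nhds 0)
        (nhds (x.1 i)) := by
      have : Continuous fun ε : ℝ => x.1 i + ε * (x.1 i - y.1 i) := by fun_prop
      simpa using this.tendsto 0
    have c₂ : Filter.Tendsto (fun ε : ℝ => x.1 i - ε * (x.1 i - y.1 i)) (nhds 0)
        (nhds (x.1 i)) := by
      have : Continuous fun ε : ℝ => x.1 i - ε * (x.1 i - y.1 i) := by fun_prop
      simpa using this.tendsto 0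
    have hmem : Set.Icc (l i) (u i) ∈ nhds (x.1 i) := Icc_mem_nhds h₁' h₂'
    exact (c₁.eventually_mem hmem).and (c₂.eventually_mem hmem)
  obtain ⟨ε, hε, hpos⟩ :=
    (((Filter.eventually_all.2 key).filter_mono nhdsWithin_le_nhds).and
      (self_mem_nhdsWithin : Set.Ioi (0 : ℝ) ∈ nhdsWithin 0 (Set.Ioi 0))).exists
  have hpos : (0 : ℝ) < ε := hpos
  have hp : x + ε • (x - y) ∈ boxSlice l u := fun i => by simpa using (hε i).1
  have hm : x - ε • (x - y) ∈ boxSlice l u := fun i => by simpa using (hε i).2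
  have := hx.2 hp hm ⟨1 / 2, 1 / 2, by norm_num, by norm_num, by norm_num, by module⟩
  have h0 : ε • (x - y) = 0 := by simpa using this
  exact sub_eq_zero.1 ((smul_eq_zero.1 h0).resolve_left hpos.ne')

theorem finite_extremePoints_boxSlice (l u : Fin n → ℝ) :
    ((boxSlice l u).extremePoints ℝ).Finite := by
  refine Set.Finite.of_finite_image
    (f := fun x : H₀ n => ({i | x.1 i = l i}, {i | x.1 i = u i})) (Set.toFinite _) ?_
  intro x hx y _ hxy
  obtain ⟨h₁, h₂⟩ := Prod.mk.inj hxy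
  exact eq_of_mem_extremePoints_boxSlice hx (fun i hi => (Set.ext_iff.1 h₁ i).1 hi)
    fun i hi => (Set.ext_iff.1 h₂ i).1 hi

/-- By Krein–Milman the slice is the closed hull of its extreme points; these are finitely many, so
the hull is already closed. -/
theorem isFullDimPolytope_boxSlice {l u : Fin n → ℝ} (hl : ∀ i, l i < 0) (hu : ∀ i, 0 < u i) :
    IsFullDimPolytope (boxSlice l u) := by
  have hfin := finite_extremePoints_boxSlice l u
  refine ⟨⟨hfin.toFinset, ?_⟩, 0, zero_mem_interior_boxSlice hl hu⟩
  rw [hfin.coe_toFinset, ← (hfin.isClosed_convexHull ℝ).closure_eq]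
  exact (closure_convexHull_extremePoints (isCompact_boxSlice l u) (convex_boxSlice l u)).symm

/-- The face of a slice of a box on which the coordinates in `A₁` are maximal and those in `A₂`
are minimal. -/
def boxFace (l u : Fin n → ℝ) (A₁ A₂ : Finset (Fin n)) : Set (H₀ n) :=
  {y ∈ boxSlice l u | (∀ i ∈ A₁, y.1 i = u i) ∧ ∀ j ∈ A₂, y.1 j = l j}

theorem boxFace_nonempty {l u : Fin n → ℝ} (hlu : ∀ i, l i ≤ u i) {A₁ A₂ : Finset (Fin n)}
    (hdisj : Disjoint A₁ A₂) (h₁ : ∑ i ∈ A₁, u i + ∑ i ∈ A₁ᶜ, l i ≤ 0)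
    (h₂ : 0 ≤ ∑ i ∈ A₂ᶜ, u i + ∑ i ∈ A₂, l i) : (boxFace l u A₁ A₂).Nonempty := by
  classical
  -- `p` and `r` are the lowest and highest box points satisfying the face equations. Their
  -- coordinate sums have opposite signs (weakly), so a point of the segment between them lies in
  -- `H₀`.
  set p : Fin n → ℝ := fun i => if i ∈ A₁ then u i else l i with hp
  set r : Fin n → ℝ := fun i => if i ∈ A₂ then l i else u i with hr
  have hps : ∑ i, p i = ∑ i ∈ A₁, u i + ∑ i ∈ A₁ᶜ, l i := by
    rw [← Finset.sum_add_sum_compl A₁ p]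
    congr 1
    · exact Finset.sum_congr rfl fun i hi => by simp [hp, hi]
    · exact Finset.sum_congr rfl fun i hi => by simp [hp, Finset.mem_compl.1 hi]
  have hrs : ∑ i, r i = ∑ i ∈ A₂ᶜ, u i + ∑ i ∈ A₂, l i := by
    rw [← Finset.sum_add_sum_compl A₂ r, add_comm]
    congr 1
    · exact Finset.sum_congr rfl fun i hi => by simp [hr, Finset.mem_compl.1 hi]
    · exact Finset.sum_congr rfl fun i hi => by simp [hr, hi]
  have h0 : (0 : ℝ) ∈ segment ℝ (∑ i, p i) (∑ i, r i) := by
    rw [segment_eq_Icc (by rw [hps, hrs]; exact h₁.trans h₂), hps, hrs]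
    exact ⟨h₁, h₂⟩
  obtain ⟨a, b, ha, hb, hab, hsum⟩ := h0
  have hpI : ∀ i, p i ∈ Set.Icc (l i) (u i) := by
    intro i
    by_cases hi : i ∈ A₁ <;> simp [hp, hi, hlu i]
  have hrI : ∀ i, r i ∈ Set.Icc (l i) (u i) := by
    intro i
    by_cases hi : i ∈ A₂ <;> simp [hr, hi, hlu i]
  refine ⟨⟨WithLp.toLp 2 fun i => a * p i + b * r i, ?_⟩, ?_, ?_, ?_⟩
  · change ∑ i, (a * p i + b * r i) = 0
    rw [Finset.sum_add_distrib, ← Finset.mul_sum, ← Finset.mul_sum]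
    exact hsum
  · intro i
    exact convex_Icc (l i) (u i) (hpI i) (hrI i) ha hb hab
  · intro i hi
    have hi' : i ∉ A₂ := Finset.disjoint_left.1 hdisj hi
    change a * p i + b * r i = u i
    simp only [hp, hr, hi, hi', if_true, if_false]
    rw [← add_mul, hab, one_mul]
  · intro i hi
    have hi' : i ∉ A₁ := Finset.disjoint_right.1 hdisj hi
    change a * p i + b * r i = l i
    simp only [hp, hr, hi, hi', if_true, if_false]
    rw [← add_mul, hab, one_mul]

theorem isExposed_boxFace (l u : Fin n → ℝ) {A₁ A₂ : Finset (Fin n)} :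
    IsExposed ℝ (boxSlice l u) (boxFace l u A₁ A₂) := by
  rintro ⟨z, hz, hz₁, hz₂⟩
  set v : H₀ n := ∑ i ∈ A₁, δ i - ∑ j ∈ A₂, δ j with hv
  have hval : ∀ y : H₀ n, ⟪v, y⟫ = ∑ i ∈ A₁, y.1 i - ∑ j ∈ A₂, y.1 j := fun y => by
    simp only [hv, inner_sub_left, sum_inner, inner_δ]
  refine ⟨innerSL ℝ v, ?_⟩
  ext y
  simp only [boxFace, Set.mem_ofPred_eq, innerSL_apply_apply, hval]
  refine and_congr_right fun hy => ⟨?_, ?_⟩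
  · rintro ⟨h₁, h₂⟩ x hx
    rw [Finset.sum_congr rfl h₁, Finset.sum_congr rfl h₂]
    exact sub_le_sub (Finset.sum_le_sum fun i _ => (hx i).2)
      (Finset.sum_le_sum fun i _ => (hx i).1)
  · intro h
    -- The point `z` of the face attains the bound `∑ u - ∑ l`, so a maximiser `y` has equality in
    -- each coordinate estimate.
    have hzy := h z hz
    rw [Finset.sum_congr rfl hz₁, Finset.sum_congr rfl hz₂] at hzy
    have e₁ : ∑ i ∈ A₁, y.1 i ≤ ∑ i ∈ A₁, u i := Finset.sum_le_sum fun i _ => (hy i).2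
    have e₂ : ∑ i ∈ A₂, l i ≤ ∑ i ∈ A₂, y.1 i := Finset.sum_le_sum fun i _ => (hy i).1
    refine ⟨(Finset.sum_eq_sum_iff_of_le fun i _ => (hy i).2).1 (by linarith), fun j hj => ?_⟩
    exact ((Finset.sum_eq_sum_iff_of_le fun i _ => (hy i).1).1 (by linarith) j hj).symm

theorem cone_le_normalCone_boxFace (l u : Fin n → ℝ) (A₁ A₂ : Finset (Fin n)) :
    cone A₁ A₂ ≤ normalCone (boxSlice l u) (boxFace l u A₁ A₂) := by
  refine Submodule.span_le.2 ?_
  rintro _ (⟨i, hi, rfl⟩ | ⟨j, hj, rfl⟩) x hx y hy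
  · rw [inner_δ, inner_δ, hx.2.1 i hi]
    exact (hy i).2
  · rw [inner_neg_left, inner_neg_left, inner_δ, inner_δ, hx.2.2 j hj]
    exact neg_le_neg (hy j).1

/-! ### From weights to polytopes -/

theorem isPseudoPolytopal_of_weights {K : Set (Finset (Fin n))} (hK : IsComplex K)
    (hproper : K ≠ Set.univ) {w : Fin n → ℝ} {q : ℝ} (hw : ∀ i, 0 < w i) (hq : 0 < q)
    (hqw : q < ∑ i, w i) (hle : ∀ X ∈ K, ∑ i ∈ X, w i ≤ q)
    (hge : ∀ X ∉ K, q ≤ ∑ i ∈ X, w i) : IsPseudoPolytopal (canonicalFan K) := by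
  set S := ∑ i, w i with hS
  have hSpos : 0 < S := hq.trans hqw
  set c := q / S with hc
  have hc0 : 0 < c := div_pos hq hSpos
  have hc1 : c < 1 := (div_lt_one hSpos).2 hqw
  have hcS : c * S = q := div_mul_cancel₀ q hSpos.ne'
  -- The box `∏ [0, w i]` is translated by `-c w`, whose coordinate sum is `-q`; `0 < c < 1` puts
  -- the origin in its interior.
  set l : Fin n → ℝ := fun i => -(c * w i) with hl
  set u : Fin n → ℝ := fun i => w i - c * w i with hu
  have hl0 : ∀ i, l i < 0 := fun i => neg_neg_of_pos (mul_pos hc0 (hw i))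
  have hu0 : ∀ i, 0 < u i := fun i => by
    have := mul_lt_mul_of_pos_right hc1 (hw i)
    simp only [hu]
    linarith
  have hsum : ∀ A : Finset (Fin n), ∑ i ∈ A, u i + ∑ i ∈ Aᶜ, l i = ∑ i ∈ A, w i - q := by
    intro A
    have hA := Finset.sum_add_sum_compl A w
    simp only [hu, hl, Finset.sum_sub_distrib, Finset.sum_neg_distrib, ← Finset.mul_sum]
    rw [← hcS, hS, ← hA]
    ring
  have hsub : ∀ C ∈ canonicalFan K, ∃ D ∈ normalFan (boxSlice l u), C ≤ D := by
    rintro _ ⟨A₁, A₂, h₁, h₂, hdisj, rfl⟩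
    refine ⟨_, ⟨boxFace l u A₁ A₂, ?_, isExposed_boxFace l u, rfl⟩,
      cone_le_normalCone_boxFace l u A₁ A₂⟩
    refine boxFace_nonempty (fun i => ((hl0 i).trans (hu0 i)).le) hdisj ?_ ?_
    · rw [hsum]
      linarith [hle A₁ h₁]
    · have := hsum A₂ᶜ
      rw [compl_compl] at this
      rw [this]
      linarith [hge A₂ᶜ h₂]
  refine ⟨boxSlice l u, isFullDimPolytope_boxSlice hl0 hu0, ?_, hsub⟩
  have huniv := iUnion_canonicalFan hK hproper
  rw [huniv]
  refine (Set.eq_univ_of_forall fun x => ?_).symm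
  obtain ⟨C, hC, hxC⟩ := Set.mem_iUnion₂.1 (huniv.symm ▸ Set.mem_univ x)
  obtain ⟨D, hD, hCD⟩ := hsub C hC
  exact Set.mem_biUnion hD (hCD hxC)

theorem IsRoughlyWeighted.isPseudoPolytopal {K : Set (Finset (Fin n))} (hn : 2 ≤ n)
    (hK : IsComplex K) (hproper : K ≠ Set.univ) (h : IsRoughlyWeighted Kᶜ) :
    IsPseudoPolytopal (canonicalFan K) := by
  obtain ⟨-, w, q, hw, hq, hX⟩ := h
  have hle : ∀ X ∈ K, ∑ i ∈ X, w i ≤ q := fun X hXK =>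
    not_lt.1 fun hlt => (hX X).1 hlt hXK
  have hge : ∀ X ∉ K, q ≤ ∑ i ∈ X, w i := fun X hXK =>
    not_lt.1 fun hlt => (hX X).2 hlt hXK
  rcases lt_or_ge q (∑ i, w i) with hqw | hqw
  · exact isPseudoPolytopal_of_weights hK hproper hw hq hqw hle hge
  have huniv := univ_notMem hK hproper
  -- Only the grand coalition wins, and equal weights with quota `n - 1` do.
  have hcard : ∀ X : Finset (Fin n), X ∉ K → X = Finset.univ := by
    intro X hXK
    by_contra hne
    obtain ⟨i, hi⟩ : ∃ i, i ∉ X := by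
      by_contra! hall
      exact hne (Finset.eq_univ_iff_forall.2 hall)
    have : ∑ i ∈ X, w i < ∑ i, w i :=
      Finset.sum_lt_sum_of_subset (Finset.subset_univ X) (Finset.mem_univ i) hi (hw i)
        fun j _ _ => (hw j).le
    linarith [hge X hXK]
  -- This makes the new quota `n - 1` positive.
  have hn' : (2 : ℝ) ≤ n := by exact_mod_cast hn
  refine isPseudoPolytopal_of_weights hK hproper (w := fun _ => 1) (q := n - 1)
    (fun _ => one_pos) (by linarith) (by simp) ?_ ?_
  · intro X hXK
    have hlt : X.card < n := by
      refine lt_of_le_of_ne (by simpa using Finset.card_le_univ X) fun heq => huniv ?_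
      rwa [← (Finset.card_eq_iff_eq_univ X).1 (by simpa using heq)]
    have : ((X.card + 1 : ℕ) : ℝ) ≤ n := by exact_mod_cast hlt
    push_cast at this
    simp only [Finset.sum_const, nsmul_eq_mul, mul_one]
    linarith
  · intro X hXK
    rw [hcard X hXK]
    simp

/-! ### From polytopes to weights -/

/-- Move from `x` along `±δ i`, whose `i`-th coordinate `±(1 - 1/n)` is nonzero once `n ≥ 2`. -/
theorem exists_lt_coord_of_mem_interior (hn : 2 ≤ n) {Q : Set (H₀ n)} {x : H₀ n}
    (hx : x ∈ interior Q) (i : Fin n) :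
    (∃ y ∈ Q, y.1 i < x.1 i) ∧ ∃ y ∈ Q, x.1 i < y.1 i := by
  have hδ : 0 < (δ i).1 i := by
    rw [δ_coord, if_pos rfl, sub_pos, div_lt_one (by positivity)]
    exact_mod_cast hn
  have hev : ∀ v : H₀ n, ∃ ε : ℝ, 0 < ε ∧ x + ε • v ∈ Q := by
    intro v
    have hcont : Filter.Tendsto (fun ε : ℝ => x + ε • v) (nhds 0) (nhds x) := by
      have : Continuous fun ε : ℝ => x + ε • v := by fun_prop
      simpa using this.tendsto 0
    have h := hcont (mem_interior_iff_mem_nhds.1 hx)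
    obtain ⟨ε, hε, hpos⟩ := ((Filter.Eventually.filter_mono nhdsWithin_le_nhds h).and
      (self_mem_nhdsWithin : Set.Ioi (0 : ℝ) ∈ nhdsWithin 0 (Set.Ioi 0))).exists
    exact ⟨ε, hpos, hε⟩
  constructor
  · obtain ⟨ε, hpos, hε⟩ := hev (-δ i)
    refine ⟨_, hε, ?_⟩
    have := mul_pos hpos hδ
    simpa using this
  · obtain ⟨ε, hpos, hε⟩ := hev (δ i)
    refine ⟨_, hε, ?_⟩
    have := mul_pos hpos hδ
    simpa using this

theorem IsPseudoPolytopal.isRoughlyWeighted {K : Set (Finset (Fin n))} (hn : 2 ≤ n)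
    (hK : IsComplex K) (hproper : K ≠ Set.univ) (h : IsPseudoPolytopal (canonicalFan K)) :
    IsRoughlyWeighted Kᶜ := by
  have huniv := univ_notMem hK hproper
  obtain ⟨Q, ⟨⟨s, hs⟩, x, hx⟩, -, href⟩ := h
  have hcomp : IsCompact Q := hs ▸ s.finite_toSet.isCompact_convexHull ℝ
  have hne : Q.Nonempty := ⟨x, interior_subset hx⟩
  choose M hMQ hM using fun i : Fin n =>
    hcomp.exists_isMaxOn hne (continuous_coord i).continuousOn
  choose m hmQ hm using fun i : Fin n =>
    hcomp.exists_isMinOn hne (continuous_coord i).continuousOn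
  set u : Fin n → ℝ := fun i => (M i).1 i with hu
  set l : Fin n → ℝ := fun i => (m i).1 i with hl
  have hyu : ∀ y ∈ Q, ∀ i, y.1 i ≤ u i := fun y hy i => hM i hy
  have hyl : ∀ y ∈ Q, ∀ i, l i ≤ y.1 i := fun y hy i => hm i hy
  -- Strictness at an interior point yields positive weights and, as the coordinates of `x` sum to
  -- zero, a positive quota.
  have hxl : ∀ i, l i < x.1 i := fun i => by
    obtain ⟨y, hy, hlt⟩ := (exists_lt_coord_of_mem_interior hn hx i).1
    exact (hyl y hy i).trans_lt hlt
  have hxu : ∀ i, x.1 i ≤ u i := hyu x (interior_subset hx)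
  have hface : ∀ A₁ A₂ : Finset (Fin n), A₁ ∈ K → A₂ ∈ alexanderDual K → Disjoint A₁ A₂ →
      ∃ p ∈ Q, (∀ i ∈ A₁, u i ≤ p.1 i) ∧ ∀ j ∈ A₂, p.1 j ≤ l j := by
    intro A₁ A₂ h₁ h₂ hdisj
    obtain ⟨_, ⟨F, ⟨p, hp⟩, hF, rfl⟩, hCD⟩ := href _ ⟨A₁, A₂, h₁, h₂, hdisj, rfl⟩
    refine ⟨p, hF.subset hp, fun i hi => ?_, fun j hj => ?_⟩
    · have := hCD (δ_mem_cone hi) p hp (M i) (hMQ i)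
      rwa [inner_δ, inner_δ] at this
    · have := hCD (neg_δ_mem_cone hj) p hp (m j) (hmQ j)
      rwa [inner_neg_left, inner_neg_left, inner_δ, inner_δ, neg_le_neg_iff] at this
  have hsum : ∀ X : Finset (Fin n),
      ∑ i ∈ X, (u i - l i) = ∑ i ∈ X, u i + ∑ i ∈ Xᶜ, l i - ∑ i, l i := by
    intro X
    rw [← Finset.sum_add_sum_compl X l, Finset.sum_sub_distrib]
    ring
  have hne : (Finset.univ : Finset (Fin n)).Nonempty := ⟨⟨0, by lia⟩, Finset.mem_univ _⟩
  refine ⟨⟨huniv, fun h => h hK.empty_mem, hK.isLowerSet.compl⟩, fun i => u i - l i,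
    -∑ i, l i, fun i => sub_pos.2 ((hxl i).trans_le (hxu i)), ?_, fun X => ⟨?_, ?_⟩⟩
  · have := Finset.sum_lt_sum_of_nonempty hne fun i _ => hxl i
    rw [sum_coord_eq_zero x] at this
    linarith
  · intro hlt hXK
    -- A point `p` maximal on `X` gives `0 = ∑ p ≥ ∑_X u + ∑_{Xᶜ} l`, that is, weight at most the
    -- quota.
    obtain ⟨p, hpQ, hp, -⟩ := hface X ∅ hXK
      (by change (∅ : Finset (Fin n))ᶜ ∉ K; rwa [Finset.compl_empty])
      (Finset.disjoint_empty_right X)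
    have e₁ := Finset.sum_le_sum hp
    have e₂ : ∑ i ∈ Xᶜ, l i ≤ ∑ i ∈ Xᶜ, p.1 i := Finset.sum_le_sum fun i _ => hyl p hpQ i
    have e₃ := Finset.sum_add_sum_compl X fun i => p.1 i
    rw [sum_coord_eq_zero p] at e₃
    rw [hsum X] at hlt
    linarith
  · intro hlt hXK
    -- Dually, a point minimal on `Xᶜ` gives `0 ≤ ∑_X u + ∑_{Xᶜ} l`.
    obtain ⟨p, hpQ, -, hp⟩ := hface ∅ Xᶜ hK.empty_mem
      (by change Xᶜᶜ ∉ K; rwa [compl_compl]) (Finset.disjoint_empty_left _)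
    have e₁ := Finset.sum_le_sum hp
    have e₂ : ∑ i ∈ X, p.1 i ≤ ∑ i ∈ X, u i := Finset.sum_le_sum fun i _ => hyu p hpQ i
    have e₃ := Finset.sum_add_sum_compl X fun i => p.1 i
    rw [sum_coord_eq_zero p] at e₃
    rw [hsum X] at hlt
    linarith

theorem two_le_of_vert_eq_univ {K : Set (Finset (Fin n))} (hK : IsComplex K)
    (hproper : K ≠ Set.univ) (hvert : vert K = Set.univ) : 2 ≤ n := by
  have huniv := univ_notMem hK hproper
  match n, K with
  | 0, K => exact absurd hK.empty_mem huniv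
  | 1, K => exact absurd (show (0 : Fin 1) ∈ vert K from hvert ▸ Set.mem_univ _) huniv
  | n + 2, _ => lia

end BierFan

theorem theorem2 (n : ℕ) (K : Set (Finset (Fin n))) (hK : BierFan.IsComplex K)
    (hproper : K ≠ Set.univ) (hvert : BierFan.vert K = Set.univ) :
    BierFan.IsRoughlyWeighted Kᶜ ↔ BierFan.IsPseudoPolytopal (BierFan.canonicalFan K) :=
  have hn := BierFan.two_le_of_vert_eq_univ hK hproper hvert
  ⟨fun h => h.isPseudoPolytopal hn hK hproper, fun h => h.isRoughlyWeighted hn hK hproper⟩
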